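/- Let $E$ be a Hausdorff locally convex real topological vector space and let $K\subset E$ be a compact convex set. Let $B\subset K$ be a boundary of $K$, that is, for every continuous affine function $f\colon K\to\mathbb R$ there is a point $b\in B$ with $f(b)=\max_{x\in K}f(x)$. Suppose that $B$, with the subspace topology, has a countable network, that is, there is a countable family $\mathcal N$ of subsets of $B$ such that every open subset of $B$ is the union of a subfamily of $\mathcal N$. Then $K$ is metrizable. -/

import Mathlib

/-- A family `N` of subsets of a topological space `X` is a network if every open set is the
union of a subfamily of `N`. -/
def IsNetwork {X : Type*} [TopologicalSpace X] (N : Set (Set X)) : Prop :=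
  ∀ U : Set X, IsOpen U → ∃ M : Set (Set X), M ⊆ N ∧ U = ⋃₀ M

/-- A topological space has a countable network. -/
def HasCountableNetwork (X : Type*) [TopologicalSpace X] : Prop :=
  ∃ N : Set (Set X), N.Countable ∧ IsNetwork N

/-- The values of `f` on the convex set `K` are those of an affine real function on `K`. Such a
function need not be the restriction of an affine function on `E`. -/
def IsAffineOn {E : Type*} [AddCommGroup E] [Module ℝ E] (K : Set E) (f : E → ℝ) : Prop :=
  ∀ x ∈ K, ∀ y ∈ K, ∀ a b : ℝ, 0 ≤ a → 0 ≤ b → a + b = 1 →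
    f (a • x + b • y) = a * f x + b * f y

/-- `B` is a boundary of the compact convex set `K`: a subset of `K` in which every continuous
affine real function on `K` attains its maximum over `K`. Only the values of `f` on `K` matter. -/
def IsBoundary {E : Type*} [AddCommGroup E] [Module ℝ E] [TopologicalSpace E]
    (K B : Set E) : Prop :=
  B ⊆ K ∧ ∀ f : E → ℝ, ContinuousOn f K → IsAffineOn K f → ∃ b ∈ B, IsMaxOn f K b

/-! Let `A` be the closed space of continuous affine functions on the compact convex set. If the
boundary is covered by an increasing sequence of sets, Simons' inequality shows that each point `x`
is dominated, up to `ε` and uniformly on the unit ball of `A`, by the supremum over a single one of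
them.

Given `f` in that ball and `δ`, the network sets on which `f` oscillates by at most `δ` cover the
boundary, so finitely many of them nearly dominate `x`. Finite-dimensional separation replaces the
maximum of their suprema by a convex combination, and the weights can then be taken rational. The
resulting inequality, tested on `f`, `-f` and the constant `-1`, makes `f` nearly constant on the
set of all points that satisfy it.

Only countably many such sets arise. Distinct points lie in two of them that some continuous
function separates; one function per separable pair gives a countable separating family, and a
compact space with such a family is metrizable. -/

/-! ### Simons' inequality and uniform domination -/

/-- Geometric tails of a sequence adapted to a decreasing sequence of bounded closed convex sets. -/
theorem exists_seq_eq_half_add_half {V : Type*} [NormedAddCommGroup V] [NormedSpace ℝ V]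
    [CompleteSpace V] {G : ℕ → Set V} (hanti : Antitone G) (hclosed : ∀ n, IsClosed (G n))
    (hconvex : ∀ n, Convex ℝ (G n)) {M : ℝ} (hbdd : ∀ g ∈ G 0, ‖g‖ ≤ M) {y : ℕ → V}
    (hy : ∀ n, y n ∈ G n) :
    ∃ t : ℕ → V, ∀ n, t n ∈ G n ∧ t n = (1 / 2 : ℝ) • y n + (1 / 2 : ℝ) • t (n + 1) := by
  have hyM : ∀ n, ‖y n‖ ≤ M := fun n => hbdd _ (hanti (Nat.zero_le n) (hy n))
  have hgeo : Summable fun j : ℕ => (1 / 2 : ℝ) ^ (j + 1) * M :=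
    ((summable_geometric_two).comp_injective (add_left_injective 1)).mul_right M
  have hsum : ∀ n, Summable fun j : ℕ => (1 / 2 : ℝ) ^ (j + 1) • y (n + j) := by
    intro n
    refine Summable.of_norm_bounded hgeo fun j => ?_
    rw [norm_smul, Real.norm_of_nonneg (by positivity)]
    exact mul_le_mul_of_nonneg_left (hyM _) (by positivity)
  -- Giving the missing mass `(1 / 2) ^ m` to the last vector makes the truncated series a convex
  -- combination. The induction covers all `n` at once, since peeling off the first term leaves the
  -- same sum for `n + 1`.
  have hpart : ∀ m n, ∑ j ∈ Finset.range m, (1 / 2 : ℝ) ^ (j + 1) • y (n + j)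
      + (1 / 2 : ℝ) ^ m • y (n + m) ∈ G n := by
    intro m
    induction m with
    | zero => intro n; simpa using hy n
    | succ m ih =>
      intro n
      have h := hconvex n (hy n) (hanti (Nat.le_succ n) (ih (n + 1)))
        (show (0 : ℝ) ≤ 1 / 2 by norm_num) (show (0 : ℝ) ≤ 1 / 2 by norm_num) (by norm_num)
      convert h using 1
      rw [Finset.sum_range_succ', smul_add, Finset.smul_sum]
      simp only [smul_smul, ← pow_succ']
      simp only [Nat.add_right_comm n 1, add_zero, zero_add, pow_one, ← add_assoc]
      abel
  refine ⟨fun n => ∑' j : ℕ, (1 / 2 : ℝ) ^ (j + 1) • y (n + j), fun n => ⟨?_, ?_⟩⟩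
  · have hlim : Filter.Tendsto (fun m : ℕ => (1 / 2 : ℝ) ^ m • y (n + m)) Filter.atTop (nhds 0) := by
      have := (hsum n).tendsto_atTop_zero.const_smul (2 : ℝ)
      rw [smul_zero] at this
      refine this.congr fun m => ?_
      rw [smul_smul, pow_succ]
      congr 1
      ring
    have h := (hsum n).hasSum.tendsto_sum_nat.add hlim
    rw [add_zero] at h
    exact (hclosed n).mem_of_tendsto h (Filter.Eventually.of_forall fun m => hpart m n)
  · simp only
    rw [(hsum n).tsum_eq_zero_add, ← (hsum (n + 1)).tsum_const_smul]
    simp only [zero_add, pow_one, add_zero, smul_smul, ← pow_succ']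
    simp only [Nat.add_right_comm n 1, ← add_assoc]

/-- A form of Simons' inequality. -/
theorem exists_boundary_point_forall_exists_neg_le {X : Type*} [TopologicalSpace X]
    [CompactSpace X] {A : Submodule ℝ C(X, ℝ)} {B : Set X}
    (hB : ∀ f ∈ A, ∃ b ∈ B, ∀ x, f x ≤ f b) {G : ℕ → Set C(X, ℝ)} (hanti : Antitone G)
    (hclosed : ∀ n, IsClosed (G n)) (hconvex : ∀ n, Convex ℝ (G n))
    (hne : ∀ n, (G n).Nonempty) (hGA : G 0 ⊆ A) {M : ℝ} (hbdd : ∀ g ∈ G 0, ‖g‖ ≤ M)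
    {x₀ : X} (hx₀ : ∀ g ∈ G 0, 0 ≤ g x₀) {δ : ℝ} (hδ : 0 < δ) :
    ∃ b ∈ B, ∀ n, ∃ t ∈ G n, -δ ≤ t b := by
  have hsub : ∀ n, G n ⊆ G 0 := fun n => hanti (Nat.zero_le n)
  have hle : ∀ (f : C(X, ℝ)) x, f x ≤ ⨆ x, f x := fun f x =>
    le_ciSup (isCompact_range f.continuous).bddAbove x
  -- Near-minimizers exist because evaluation at `x₀` bounds the suprema below. The error `(1 / 4) ^
  -- n` still leaves `(1 / 2) ^ n` after division by the weight of `y`.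
  have hmin : ∀ (n : ℕ) (s : C(X, ℝ)), ∃ y ∈ G n, ∀ h ∈ G n,
      (⨆ x, (s + (1 / 2 : ℝ) ^ n • y) x) ≤
        (⨆ x, (s + (1 / 2 : ℝ) ^ n • h) x) + δ / 4 * (1 / 4 : ℝ) ^ n := by
    intro n s
    set p : C(X, ℝ) → ℝ := fun h => ⨆ x, (s + (1 / 2 : ℝ) ^ n • h) x with hp
    have hbelow : BddBelow (p '' G n) := by
      refine ⟨s x₀, ?_⟩
      rintro _ ⟨h, hh, rfl⟩
      refine le_trans ?_ (hle _ x₀)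
      have := hx₀ h (hsub n hh)
      have h2 : (0 : ℝ) ≤ (1 / 2 : ℝ) ^ n * h x₀ := by positivity
      simpa using h2
    obtain ⟨_, ⟨y, hy, rfl⟩, hlt⟩ := exists_lt_of_csInf_lt ((hne n).image p)
      (lt_add_of_pos_right (sInf (p '' G n)) (show 0 < δ / 4 * (1 / 4 : ℝ) ^ n by positivity))
    refine ⟨y, hy, fun h hh => hlt.le.trans ?_⟩
    gcongr
    exact csInf_le hbelow ⟨h, hh, rfl⟩
  choose Y hYG hYmin using hmin
  let s : ℕ → C(X, ℝ) := fun n => Nat.rec 0 (fun n s => s + (1 / 2 : ℝ) ^ (n + 1) • Y n s) n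
  have hs : ∀ n, s (n + 1) = s n + (1 / 2 : ℝ) ^ (n + 1) • Y n (s n) := fun n => rfl
  obtain ⟨t, ht⟩ := exists_seq_eq_half_add_half hanti hclosed hconvex hbdd
    (fun n => hYG n (s n))
  have ht0 : ∀ n, t 0 = s n + (1 / 2 : ℝ) ^ n • t n := by
    intro n
    induction n with
    | zero => simp [s]
    | succ n ih =>
      rw [ih, hs, (ht n).2, smul_add, smul_smul, smul_smul, pow_succ, add_assoc]
  obtain ⟨b, hb, hmax⟩ := hB (t 0) (hGA (ht 0).1)
  have hmax' : ⨆ x, t 0 x ≤ t 0 b := by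
    have : Nonempty X := ⟨b⟩
    exact ciSup_le hmax
  -- The tail `t n` competes with the near-minimizer `Y n (s n)`, and `s n + (1 / 2) ^ n • t n` is
  -- `t 0`, whose maximum is attained at `b`.
  have hY : ∀ n, Y n (s n) b ≤ t n b + δ / 4 * (1 / 2 : ℝ) ^ n := by
    intro n
    have h := (hle _ b).trans (hYmin n (s n) (t n) (ht n).1)
    rw [← ht0 n] at h
    have h2 := h.trans (add_le_add_left hmax' _)
    have h3 : t 0 b = s n b + (1 / 2 : ℝ) ^ n * t n b := by
      rw [ht0 n]; simp
    have h4 : (s n + (1 / 2 : ℝ) ^ n • Y n (s n)) b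
      = s n b + (1 / 2 : ℝ) ^ n * Y n (s n) b := by simp
    rw [h3, h4] at h2
    have h5 : (1 / 4 : ℝ) ^ n = (1 / 2) ^ n * (1 / 2) ^ n := by
      rw [← mul_pow]; norm_num
    rw [h5] at h2
    have hpos : (0 : ℝ) < (1 / 2) ^ n := by positivity
    refine le_of_mul_le_mul_left ?_ hpos
    linarith
  have ht0b : 0 ≤ t 0 b := (hx₀ _ (ht 0).1).trans (hmax x₀)
  -- Since `t (n + 1) = 2 t n - Y n (s n)`, passing to the next tail loses at most `δ / 4 * (1 / 2)
  -- ^ n` at `b`; these losses total less than `δ / 2`.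
  have hlow : ∀ n, -(δ / 2) * (1 - (1 / 2 : ℝ) ^ n) ≤ t n b := by
    intro n
    induction n with
    | zero => simpa using ht0b
    | succ n ih =>
      have h1 : t n b = 1 / 2 * Y n (s n) b + 1 / 2 * t (n + 1) b := by
        conv_lhs => rw [(ht n).2]
        simp
      have := hY n
      rw [pow_succ]
      linarith
  refine ⟨b, hb, fun n => ⟨t n, (ht n).1, le_trans ?_ (hlow n)⟩⟩
  have hpos : (0 : ℝ) < (1 / 2) ^ n := by positivity
  nlinarith

/-- If a boundary is covered by an increasing sequence of sets, then every point evaluation is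
almost dominated, uniformly on the unit ball, by the supremum over some member of the sequence. -/
theorem exists_forall_exists_le_add {X : Type*} [TopologicalSpace X]
    [CompactSpace X] {A : Submodule ℝ C(X, ℝ)} (hA : IsClosed (A : Set C(X, ℝ)))
    (hconst : ContinuousMap.const X (1 : ℝ) ∈ A) {B : Set X}
    (hB : ∀ f ∈ A, ∃ b ∈ B, ∀ x, f x ≤ f b) {C : ℕ → Set X} (hC : Monotone C)
    (hBC : ∀ b ∈ B, ∃ n, b ∈ C n) (x₀ : X) {ε : ℝ} (hε : 0 < ε) :
    ∃ n, ∀ f ∈ A, ‖f‖ ≤ 1 → ∃ b ∈ C n, f x₀ ≤ f b + ε := by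
  by_contra! h
  -- The counterexamples `f`, translated to `f - f x₀`, lie in these sets, hence the norm bound 2. A
  -- boundary point from Simons' inequality lies in some `C n`, where `-ε / 2 ≤ t b ≤ -ε` is
  -- impossible.
  let G : ℕ → Set C(X, ℝ) := fun n =>
    {g | g ∈ A ∧ ‖g‖ ≤ 2 ∧ g x₀ = 0 ∧ ∀ b ∈ C n, g b ≤ -ε}
  have heval : ∀ x : X, Continuous fun g : C(X, ℝ) => g x := fun x =>
    continuous_eval_const x
  have hGanti : Antitone G := fun m n hmn g hg =>
    ⟨hg.1, hg.2.1, hg.2.2.1, fun b hb => hg.2.2.2 b (hC hmn hb)⟩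
  have hGclosed : ∀ n, IsClosed (G n) := by
    intro n
    refine hA.inter ((isClosed_le continuous_norm continuous_const).inter
      ((isClosed_eq (heval x₀) continuous_const).inter ?_))
    have : {g : C(X, ℝ) | ∀ b ∈ C n, g b ≤ -ε} = ⋂ b ∈ C n, {g | g b ≤ -ε} := by
      ext; simp
    change IsClosed {g : C(X, ℝ) | ∀ b ∈ C n, g b ≤ -ε}
    rw [this]
    exact isClosed_biInter fun b _ => isClosed_le (heval b) continuous_const
  have hGconvex : ∀ n, Convex ℝ (G n) := by
    rintro n f ⟨hf1, hf2, hf3, hf4⟩ g ⟨hg1, hg2, hg3, hg4⟩ a c ha hc hac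
    refine ⟨A.add_mem (A.smul_mem a hf1) (A.smul_mem c hg1), ?_, by simp [hf3, hg3], ?_⟩
    · refine (norm_add_le _ _).trans ?_
      rw [norm_smul, norm_smul, Real.norm_of_nonneg ha, Real.norm_of_nonneg hc]
      nlinarith
    · intro b hb
      have h1 := hf4 b hb
      have h2 := hg4 b hb
      simp only [ContinuousMap.add_apply, ContinuousMap.smul_apply, smul_eq_mul]
      nlinarith
  have hGne : ∀ n, (G n).Nonempty := by
    intro n
    obtain ⟨f, hf, hf1, hfn⟩ := h n
    have hfx : |f x₀| ≤ 1 := (f.norm_coe_le_norm x₀).trans hf1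
    refine ⟨f - f x₀ • ContinuousMap.const X (1 : ℝ), A.sub_mem hf (A.smul_mem _ hconst), ?_,
      by simp, fun b hb => ?_⟩
    · rw [ContinuousMap.norm_le _ (by norm_num)]
      intro x
      have hx : |f x| ≤ 1 := (f.norm_coe_le_norm x).trans hf1
      have h2 : |f x - f x₀| ≤ 2 := by
        rw [abs_le] at *
        constructor <;> linarith
      simpa using h2
    · have := hfn b hb
      simp only [ContinuousMap.sub_apply, ContinuousMap.smul_apply, ContinuousMap.const_apply,
        smul_eq_mul, mul_one]
      linarith
  obtain ⟨b, hb, hbn⟩ := exists_boundary_point_forall_exists_neg_le hB hGanti hGclosed hGconvex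
    hGne (fun g hg => hg.1) (fun g hg => hg.2.1) (x₀ := x₀) (fun g hg => hg.2.2.1.ge)
    (half_pos hε)
  obtain ⟨n, hn⟩ := hBC b hb
  obtain ⟨t, ht, htb⟩ := hbn n
  have := ht.2.2.2 b hn
  linarith

/-! ### Separation in finite dimension and rational weights -/

/-- A convex set of vectors none of which has all its coordinates positive lies in a half-space
given by nonnegative weights. -/
theorem Convex.exists_weights_sum_mul_nonpos {S : Type*} [Fintype S] [Nonempty S]
    {V : Set (S → ℝ)} (hV : Convex ℝ V) (hne : V.Nonempty) (h : ∀ v ∈ V, ∃ k, v k ≤ 0) :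
    ∃ a : S → ℝ, (∀ k, 0 ≤ a k) ∧ ∑ k, a k = 1 ∧ ∀ v ∈ V, ∑ k, a k * v k ≤ 0 := by
  classical
  let O : Set (S → ℝ) := Set.univ.pi fun _ => Set.Ioi 0
  have hO : IsOpen O := isOpen_set_pi Set.finite_univ fun _ _ => isOpen_Ioi
  have hOc : Convex ℝ O := convex_pi fun _ _ => convex_Ioi 0
  have hdisj : Disjoint O V := by
    rw [Set.disjoint_left]
    intro v hv hvV
    obtain ⟨k, hk⟩ := h v hvV
    exact absurd (hv k trivial) (not_lt.mpr hk)
  obtain ⟨φ, u, hφO, hφV⟩ := geometric_hahn_banach_open hOc hO hV hdisj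
  have hφ : ∀ v, φ v = ∑ k, v k * φ (Pi.single k 1) := by
    intro v
    conv_lhs => rw [pi_eq_sum_univ' v, map_sum]
    refine Finset.sum_congr rfl fun k _ => ?_
    rw [map_smul, smul_eq_mul]
  -- Adding `r • 1` pushes a nonnegative vector into the open orthant. Large `M` then forces `φ` to
  -- be nonpositive on the basis, and small `r` forces `0 ≤ u`.
  have hbound : ∀ (p : S → ℝ), (∀ k, 0 ≤ p k) → ∀ M : ℝ, 0 ≤ M → ∀ r : ℝ, 0 < r →
      M * φ p + r * φ 1 < u := by
    intro p hp M hM r hr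
    have := hφO (M • p + r • (1 : S → ℝ)) fun k _ => by
      have := mul_nonneg hM (hp k)
      simp only [Set.mem_Ioi, Pi.add_apply, Pi.smul_apply, smul_eq_mul, Pi.one_apply]
      linarith
    simpa using this
  have hneg : ∀ k, φ (Pi.single k 1) ≤ 0 := by
    intro k
    by_contra! hk
    have hp : ∀ j, (0 : ℝ) ≤ (Pi.single k 1 : S → ℝ) j := fun j => by
      by_cases hj : j = k <;> simp [hj]
    have h1 := hbound _ hp (|u - φ 1| / φ (Pi.single k 1)) (by positivity) 1 one_pos
    rw [div_mul_cancel₀ _ hk.ne'] at h1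
    have := le_abs_self (u - φ 1)
    linarith
  have hu : 0 ≤ u := by
    by_contra! hu
    have h1 := hbound 0 (fun _ => le_rfl) 0 le_rfl (-u / (2 * (|φ 1| + 1)))
      (div_pos (by linarith) (by positivity))
    have h2 : -u / (2 * (|φ 1| + 1)) * φ 1 ≥ u / 2 := by
      have h3 := neg_abs_le (φ 1)
      rw [ge_iff_le, div_mul_eq_mul_div, le_div_iff₀ (by positivity)]
      nlinarith
    linarith
  have hsum : 0 < ∑ k, -φ (Pi.single k 1) := by
    refine lt_of_le_of_ne (Finset.sum_nonneg fun k _ => neg_nonneg.mpr (hneg k)) fun h0 => ?_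
    have hz := (Finset.sum_eq_zero_iff_of_nonneg fun k _ => neg_nonneg.mpr (hneg k)).mp h0.symm
    have hφ0 : ∀ v, φ v = 0 := fun v => by
      rw [hφ]
      exact Finset.sum_eq_zero fun k hk => by rw [neg_eq_zero.mp (hz k hk), mul_zero]
    obtain ⟨v, hv⟩ := hne
    have h1 := hφO 1 fun k _ => by simp
    have h2 := hφV v hv
    rw [hφ0] at h1 h2
    linarith
  set σ := ∑ k, -φ (Pi.single k 1)
  refine ⟨fun k => -φ (Pi.single k 1) / σ, fun k => div_nonneg (neg_nonneg.mpr (hneg k)) hsum.le,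
    by rw [← Finset.sum_div, div_self hsum.ne'], fun v hv => ?_⟩
  have h1 : ∑ k, -φ (Pi.single k 1) / σ * v k = -φ v / σ := by
    rw [hφ v, ← Finset.sum_neg_distrib, Finset.sum_div]
    exact Finset.sum_congr rfl fun k _ => by ring
  rw [h1]
  have := hφV v hv
  exact div_nonpos_of_nonpos_of_nonneg (by linarith) hsum.le


theorem ContinuousMap.le_sSup_image {X : Type*} [TopologicalSpace X] [CompactSpace X]
    (f : C(X, ℝ)) {s : Set X} {x : X} (hx : x ∈ s) : f x ≤ sSup (f '' s) :=
  le_csSup ((isCompact_range f.continuous).bddAbove.mono (Set.image_subset_range _ _))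
    ⟨x, hx, rfl⟩

theorem ContinuousMap.sSup_image_le {X : Type*} [TopologicalSpace X]
    (f : C(X, ℝ)) {s : Set X} (hs : s.Nonempty) {c : ℝ} (h : ∀ x ∈ s, f x ≤ c) :
    sSup (f '' s) ≤ c :=
  csSup_le (hs.image f) (by rintro _ ⟨x, hx, rfl⟩; exact h x hx)

/-- A point evaluation dominated by a maximum of finitely many suprema is dominated by a convex
combination of them. -/
theorem exists_weights_le_sum_sSup_image {X : Type*} [TopologicalSpace X]
    [CompactSpace X] {A : Submodule ℝ C(X, ℝ)} {N : ℕ → Set X} (hN : ∀ k, (N k).Nonempty)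
    {S : Finset ℕ} {x : X} {ε : ℝ}
    (h : ∀ f ∈ A, ‖f‖ ≤ 1 → ∃ k ∈ S, ∃ b ∈ N k, f x ≤ f b + ε) :
    ∃ a : ℕ → ℝ, (∀ k, 0 ≤ a k) ∧
      ∀ f ∈ A, ‖f‖ ≤ 1 → f x ≤ ∑ k ∈ S, a k * sSup (f '' N k) + ε := by
  obtain ⟨k₀, hk₀, -⟩ := h 0 A.zero_mem (by simp)
  have : Nonempty S := ⟨⟨k₀, hk₀⟩⟩
  -- Each `f x - sSup (f '' N k) - ε` is concave in `f`, so the attained vectors need not form a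
  -- convex set, but the vectors lying below them do.
  let V : Set (S → ℝ) := {v | ∃ f ∈ A, ‖f‖ ≤ 1 ∧ ∀ k : S, v k ≤ f x - sSup (f '' N k) - ε}
  have hV : Convex ℝ V := by
    rintro v ⟨f, hf, hf1, hfv⟩ w ⟨g, hg, hg1, hgw⟩ a c ha hc hac
    refine ⟨a • f + c • g, A.add_mem (A.smul_mem a hf) (A.smul_mem c hg), ?_, fun k => ?_⟩
    · refine (norm_add_le _ _).trans ?_
      rw [norm_smul, norm_smul, Real.norm_of_nonneg ha, Real.norm_of_nonneg hc]
      nlinarith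
    · have hsup : sSup ((a • f + c • g : C(X, ℝ)) '' N k) ≤
          a * sSup (f '' N k) + c * sSup (g '' N k) := by
        refine ContinuousMap.sSup_image_le _ (hN k) fun y hy => ?_
        have h1 := mul_le_mul_of_nonneg_left (f.le_sSup_image hy) ha
        have h2 := mul_le_mul_of_nonneg_left (g.le_sSup_image hy) hc
        simpa using add_le_add h1 h2
      have h1 := mul_le_mul_of_nonneg_left (hfv k) ha
      have h2 := mul_le_mul_of_nonneg_left (hgw k) hc
      have h3 : ε = a * ε + c * ε := by rw [← add_mul, hac, one_mul]
      have h4 : (a • f + c • g) x = a * f x + c * g x := rfl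
      simp only [Pi.add_apply, Pi.smul_apply, smul_eq_mul]
      rw [h4]
      linarith
  have hne : V.Nonempty := ⟨fun k => (0 : C(X, ℝ)) x - sSup ((0 : C(X, ℝ)) '' N k) - ε,
    0, A.zero_mem, by simp, fun k => le_rfl⟩
  obtain ⟨a, ha, hsum, hle⟩ := hV.exists_weights_sum_mul_nonpos hne (by
    rintro v ⟨f, hf, hf1, hfv⟩
    obtain ⟨k, hk, b, hb, hfb⟩ := h f hf hf1
    refine ⟨⟨k, hk⟩, (hfv ⟨k, hk⟩).trans ?_⟩
    have := f.le_sSup_image hb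
    linarith)
  refine ⟨fun k => if hk : k ∈ S then a ⟨k, hk⟩ else 0, fun k => ?_, fun f hf hf1 => ?_⟩
  · dsimp only
    split_ifs
    exacts [ha _, le_rfl]
  · have h1 := hle _ ⟨f, hf, hf1, fun k => le_rfl⟩
    have h2 : ∑ k, a k * (f x - sSup (f '' N k) - ε)
        = (∑ k, a k) * (f x - ε) - ∑ k, a k * sSup (f '' N k) := by
      rw [Finset.sum_mul, ← Finset.sum_sub_distrib]
      exact Finset.sum_congr rfl fun k _ => by ring
    rw [← Finset.sum_coe_sort S]
    simp only [Finset.coe_mem, dif_pos, Subtype.coe_eta]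
    rw [h2, hsum] at h1
    linarith

/-- Rounding the weights to rationals leaves only countably many weight systems, at the cost of an
arbitrarily small `η`. -/
theorem exists_finsupp_rat_le_sum_sSup_image {X : Type*} [TopologicalSpace X]
    [CompactSpace X] {A : Submodule ℝ C(X, ℝ)} {N : ℕ → Set X} (hN : ∀ k, (N k).Nonempty)
    {S : Finset ℕ} {x : X} {ε : ℝ}
    (h : ∀ f ∈ A, ‖f‖ ≤ 1 → ∃ k ∈ S, ∃ b ∈ N k, f x ≤ f b + ε) {η : ℝ} (hη : 0 < η) :
    ∃ q : ℕ →₀ ℚ, q.support ⊆ S ∧ (∀ k, 0 ≤ q k) ∧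
      ∀ f ∈ A, ‖f‖ ≤ 1 → f x ≤ q.sum (fun k c => (c : ℝ) * sSup (f '' N k)) + ε + η := by
  classical
  obtain ⟨a, ha, hle⟩ := exists_weights_le_sum_sSup_image hN h
  have hpos : 0 < η / (S.card + 1) := by positivity
  choose r hr1 hr2 using fun k => exists_rat_btwn (lt_add_of_pos_right (a k) hpos)
  have hsupp : (Finsupp.onFinset S (fun k => if k ∈ S then r k else 0)
      (fun k hk => by by_contra hkS; simp [hkS] at hk)).support ⊆ S :=
    Finsupp.support_onFinset_subset
  refine ⟨_, hsupp, fun k => ?_, fun f hf hf1 => ?_⟩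
  · simp only [Finsupp.onFinset_apply]
    split_ifs
    · exact_mod_cast (ha k).trans (hr1 k).le
    · exact le_rfl
  · rw [Finsupp.sum_of_support_subset _ hsupp _ (by simp)]
    have h1 := hle f hf hf1
    have h2 : ∑ k ∈ S, a k * sSup (f '' N k) ≤
        ∑ k ∈ S, ((r k : ℝ) * sSup (f '' N k) + η / (S.card + 1)) := by
      refine Finset.sum_le_sum fun k _ => ?_
      obtain ⟨y, hy⟩ := hN k
      -- As the supremum is at least `-1`, raising its weight by at most `η / (S.card + 1)` lowers
      -- the term by at most that much.
      have h3 : -1 ≤ sSup (f '' N k) := by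
        have := (abs_le.mp ((f.norm_coe_le_norm y).trans hf1)).1
        exact this.trans (f.le_sSup_image hy)
      have := hr1 k
      have := hr2 k
      nlinarith
    have h4 : ∑ k ∈ S, ((if k ∈ S then r k else 0 : ℚ) : ℝ) * sSup (f '' N k)
        = ∑ k ∈ S, (r k : ℝ) * sSup (f '' N k) :=
      Finset.sum_congr rfl fun k hk => by rw [if_pos hk]
    simp only [Finsupp.onFinset_apply]
    rw [h4]
    rw [Finset.sum_add_distrib, Finset.sum_const, nsmul_eq_mul] at h2
    have h5 : (S.card : ℝ) * (η / (S.card + 1)) ≤ η := by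
      rw [mul_div_assoc', div_le_iff₀ (by positivity)]
      nlinarith
    linarith

/-! ### Weighted hulls and the metrizability criterion -/

/-- The points whose evaluations on the unit ball of `A` are dominated, up to `r`, by the weighted
sum of the suprema over the sets `N k` with weights `q k`. -/
def weightedHull {X : Type*} [TopologicalSpace X] [CompactSpace X] (A : Submodule ℝ C(X, ℝ))
    (N : ℕ → Set X) (q : ℕ →₀ ℚ) (r : ℚ) : Set X :=
  {x | ∀ f ∈ A, ‖f‖ ≤ 1 → f x ≤ q.sum (fun k c => (c : ℝ) * sSup (f '' N k)) + r}

/-- The weighted hulls form a network for the topology generated by `A`. -/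
theorem exists_mem_weightedHull_forall_abs_sub_le {X : Type*} [TopologicalSpace X]
    [CompactSpace X] {A : Submodule ℝ C(X, ℝ)} (hA : IsClosed (A : Set C(X, ℝ)))
    (hconst : ContinuousMap.const X (1 : ℝ) ∈ A) {B : Set X}
    (hB : ∀ f ∈ A, ∃ b ∈ B, ∀ x, f x ≤ f b) {N : ℕ → Set X} (hN : ∀ k, (N k).Nonempty)
    (hnet : ∀ b ∈ B, ∀ U, IsOpen U → b ∈ U → ∃ k, b ∈ N k ∧ N k ⊆ U)
    {f : C(X, ℝ)} (hf : f ∈ A) (hf1 : ‖f‖ ≤ 1) (x : X) {δ : ℚ} (hδ : 0 < δ) (hδ1 : δ ≤ 1) :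
    ∃ q : ℕ →₀ ℚ, x ∈ weightedHull A N q δ ∧
      ∀ y ∈ weightedHull A N q δ, |f y - f x| ≤ 4 * δ := by
  classical
  have hδ' : (0 : ℝ) < δ := by exact_mod_cast hδ
  have hδ1' : (δ : ℝ) ≤ 1 := by exact_mod_cast hδ1
  -- These indices mark the network sets on which `f` oscillates by at most `δ`; they suffice to
  -- cover `B` by continuity of `f`.
  let I : Set ℕ := {k | ∀ b ∈ N k, ∀ c ∈ N k, f b ≤ f c + δ}
  let C : ℕ → Set X := fun n => ⋃ k ∈ (Finset.range n).filter (· ∈ I), N k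
  have hC : Monotone C := fun m n hmn => Set.biUnion_subset_biUnion_left fun k hk => by
    simp only [SetLike.mem_coe, Finset.mem_filter, Finset.mem_range] at hk ⊢
    exact ⟨hk.1.trans_le hmn, hk.2⟩
  have hBC : ∀ b ∈ B, ∃ n, b ∈ C n := by
    intro b hb
    obtain ⟨k, hbk, hk⟩ := hnet b hb (f ⁻¹' Metric.ball (f b) (δ / 2))
      (Metric.isOpen_ball.preimage f.continuous) (by simpa using hδ)
    refine ⟨k + 1, Set.mem_biUnion (x := k) ?_ hbk⟩
    simp only [SetLike.mem_coe, Finset.mem_filter, Finset.mem_range]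
    refine ⟨k.lt_succ_self, fun c hc d hd => ?_⟩
    have h1 := hk hc
    have h2 := hk hd
    simp only [Set.mem_preimage, Metric.mem_ball, Real.dist_eq, abs_lt] at h1 h2
    linarith
  obtain ⟨n, hn⟩ := exists_forall_exists_le_add hA hconst hB hC hBC x (half_pos hδ')
  obtain ⟨q, hqS, hq0, hq⟩ := exists_finsupp_rat_le_sum_sSup_image hN
    (S := (Finset.range n).filter (· ∈ I)) (x := x) (fun g hg hg1 => by
      obtain ⟨b, hb, hgb⟩ := hn g hg hg1
      obtain ⟨k, hk, hbk⟩ := Set.mem_iUnion₂.mp hb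
      exact ⟨k, hk, b, hbk, hgb⟩) (half_pos hδ')
  have hx : x ∈ weightedHull A N q δ := fun g hg hg1 => (hq g hg hg1).trans_eq (by ring)
  have hneg : ‖-f‖ ≤ 1 := by rwa [norm_neg]
  -- Testing the domination on the constant `-1` bounds the total weight.
  have hq1 : q.sum (fun _ c => (c : ℝ)) ≤ 1 + δ := by
    have hone : ‖-ContinuousMap.const X (1 : ℝ)‖ ≤ 1 := by
      rw [ContinuousMap.norm_le _ zero_le_one]
      simp
    have h := hx _ (A.neg_mem hconst) hone
    have h2 : q.sum (fun k c => (c : ℝ) * sSup ((-ContinuousMap.const X (1 : ℝ)) '' N k))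
        ≤ q.sum (fun _ c => -(c : ℝ)) := by
      refine Finset.sum_le_sum fun k _ => ?_
      have : sSup ((-ContinuousMap.const X (1 : ℝ)) '' N k) ≤ -1 :=
        ContinuousMap.sSup_image_le (-ContinuousMap.const X (1 : ℝ)) (hN k) (by simp)
      have h0 : (0 : ℝ) ≤ q k := by exact_mod_cast hq0 k
      nlinarith
    have h3 : q.sum (fun _ c => -(c : ℝ)) = -q.sum (fun _ c => (c : ℝ)) :=
      Finset.sum_neg_distrib _
    simp only [ContinuousMap.neg_apply, ContinuousMap.const_apply] at h
    have h' : -1 ≤ q.sum (fun _ c => -(c : ℝ)) + δ := h.trans (add_le_add_left h2 _)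
    linarith
  -- On each set used, the suprema of `f` and `-f` add up to at most `δ`; the total is at most `(1 +
  -- δ) * δ ≤ 2 * δ`.
  have hosc : q.sum (fun k c => (c : ℝ) * sSup (f '' N k)) +
      q.sum (fun k c => (c : ℝ) * sSup ((-f : C(X, ℝ)) '' N k)) ≤ 2 * δ := by
    have h1 : q.sum (fun k c => (c : ℝ) * sSup (f '' N k)) +
      q.sum (fun k c => (c : ℝ) * sSup ((-f : C(X, ℝ)) '' N k)) ≤
        q.sum (fun _ c => (c : ℝ)) * δ := by
      simp only [Finsupp.sum]
      rw [← Finset.sum_add_distrib, Finset.sum_mul]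
      refine Finset.sum_le_sum fun k hk => ?_
      have hkI : k ∈ I := (Finset.mem_filter.mp (hqS hk)).2
      have h2 : sSup ((-f : C(X, ℝ)) '' N k) ≤ δ - sSup (f '' N k) := by
        refine ContinuousMap.sSup_image_le _ (hN k) fun c hc => ?_
        have := ContinuousMap.sSup_image_le f (hN k) fun b hb => hkI b hb c hc
        simp only [ContinuousMap.neg_apply]
        linarith
      have h0 : (0 : ℝ) ≤ q k := by exact_mod_cast hq0 k
      rw [← mul_add]
      exact mul_le_mul_of_nonneg_left (by linarith) h0
    nlinarith
  have hdiff : ∀ y ∈ weightedHull A N q δ, ∀ z ∈ weightedHull A N q δ, f y - f z ≤ 4 * δ := by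
    intro y hy z hz
    have h1 := hy f hf hf1
    have h2 := hz (-f) (A.neg_mem hf) hneg
    rw [ContinuousMap.neg_apply] at h2
    linarith
  refine ⟨q, hx, fun y hy => abs_le.mpr ⟨?_, hdiff y hy x hx⟩⟩
  have := hdiff x hx y hy
  linarith

/-- A compact space is metrizable as soon as some point-separating closed subspace of its
continuous functions containing the constants has a boundary with a countable network. -/
theorem metrizableSpace_of_boundary_network {X : Type*} [TopologicalSpace X]
    [CompactSpace X] {A : Submodule ℝ C(X, ℝ)} (hA : IsClosed (A : Set C(X, ℝ)))
    (hconst : ContinuousMap.const X (1 : ℝ) ∈ A)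
    (hsep : ∀ x y : X, x ≠ y → ∃ f ∈ A, f x ≠ f y) {B : Set X}
    (hB : ∀ f ∈ A, ∃ b ∈ B, ∀ x, f x ≤ f b) {N : ℕ → Set X} (hN : ∀ k, (N k).Nonempty)
    (hnet : ∀ b ∈ B, ∀ U, IsOpen U → b ∈ U → ∃ k, b ∈ N k ∧ N k ⊆ U) :
    TopologicalSpace.MetrizableSpace X := by
  classical
  -- One function is fixed for each pair of hulls that can be separated pointwise, and `0` for the
  -- others; the index set is countable.
  have key : ∀ i : (ℕ →₀ ℚ) × (ℕ →₀ ℚ) × ℚ, ∃ g : C(X, ℝ),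
      (∃ f : C(X, ℝ), ∀ x ∈ weightedHull A N i.1 i.2.2, ∀ y ∈ weightedHull A N i.2.1 i.2.2,
        f x ≠ f y) →
      ∀ x ∈ weightedHull A N i.1 i.2.2, ∀ y ∈ weightedHull A N i.2.1 i.2.2, g x ≠ g y := by
    intro i
    by_cases h : ∃ f : C(X, ℝ), ∀ x ∈ weightedHull A N i.1 i.2.2,
      ∀ y ∈ weightedHull A N i.2.1 i.2.2, f x ≠ f y
    · exact ⟨h.choose, fun _ => h.choose_spec⟩
    · exact ⟨0, fun h' => absurd h' h⟩
  choose g hg using key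
  obtain ⟨e, he⟩ := exists_surjective_nat ((ℕ →₀ ℚ) × (ℕ →₀ ℚ) × ℚ)
  refine Metric.PiNatEmbed.TopologicalSpace.MetrizableSpace.of_countable_separating (fun n x => g (e n) x)
    (fun n => (g (e n)).continuous) fun x y hxy => ?_
  obtain ⟨f₀, hf₀, hne⟩ := hsep x y hxy
  obtain ⟨f, hf, hf1, hfne⟩ : ∃ f ∈ A, ‖f‖ ≤ 1 ∧ f x ≠ f y := by
    have hpos : 0 < ‖f₀‖ := norm_pos_iff.mpr (by rintro rfl; simp at hne)
    refine ⟨‖f₀‖⁻¹ • f₀, A.smul_mem _ hf₀, ?_, ?_⟩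
    · rw [norm_smul, norm_inv, norm_norm, inv_mul_cancel₀ hpos.ne']
    · simpa [hpos.ne'] using hne
  have habs : 0 < |f x - f y| := abs_pos.mpr (sub_ne_zero.mpr hfne)
  -- With `8 * δ < |f x - f y|`, the values of `f` on the two hulls, within `4 * δ` of `f x` and `f
  -- y`, cannot coincide.
  obtain ⟨δ, hδ0, hδ⟩ := exists_rat_btwn (lt_min (show 0 < |f x - f y| / 8 by positivity) one_pos)
  have hδ0' : 0 < δ := by exact_mod_cast hδ0
  have hδ1 : δ ≤ 1 := by exact_mod_cast (hδ.trans_le (min_le_right _ _)).le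
  have hδ8 := hδ.trans_le (min_le_left _ _)
  obtain ⟨p, hxp, hp⟩ := exists_mem_weightedHull_forall_abs_sub_le hA hconst hB hN hnet hf hf1 x
    hδ0' hδ1
  obtain ⟨q, hyq, hq⟩ := exists_mem_weightedHull_forall_abs_sub_le hA hconst hB hN hnet hf hf1 y
    hδ0' hδ1
  obtain ⟨n, hn⟩ := he (p, q, δ)
  refine ⟨n, ?_⟩
  simp only [hn]
  refine hg (p, q, δ) ⟨f, fun x' hx' y' hy' heq => ?_⟩ x hxp y hyq
  have h1 := hp x' hx'
  have h2 := hq y' hy'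
  rw [heq] at h1
  have h3 : |f x - f y| ≤ |f y' - f x| + |f y' - f y| := by
    rw [abs_sub_comm (f y') (f x)]
    exact abs_sub_le _ _ _
  linarith

/-! ### Continuous affine functions on a compact convex set -/

/-- The continuous functions on `K` whose values are those of an affine function. -/
def affineContinuousMaps {E : Type*} [AddCommGroup E] [Module ℝ E] [TopologicalSpace E]
    (K : Set E) : Submodule ℝ C(K, ℝ) where
  carrier := {f | ∀ (x y z : K) (a b : ℝ), 0 ≤ a → 0 ≤ b → a + b = 1 →
    (z : E) = a • (x : E) + b • (y : E) → f z = a * f x + b * f y}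
  zero_mem' := by intro x y z a b _ _ _ _; simp
  add_mem' := by
    intro f g hf hg x y z a b ha hb hab hz
    simp only [ContinuousMap.add_apply, hf x y z a b ha hb hab hz, hg x y z a b ha hb hab hz]
    ring
  smul_mem' := by
    intro c f hf x y z a b ha hb hab hz
    simp only [ContinuousMap.smul_apply, smul_eq_mul, hf x y z a b ha hb hab hz]
    ring

theorem isClosed_affineContinuousMaps {E : Type*} [AddCommGroup E] [Module ℝ E]
    [TopologicalSpace E] (K : Set E) [CompactSpace K] :
    IsClosed (affineContinuousMaps K : Set C(K, ℝ)) := by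
  have heval : ∀ x : K, Continuous fun g : C(K, ℝ) => g x := fun x => continuous_eval_const x
  have : (affineContinuousMaps K : Set C(K, ℝ)) = {f | ∀ (x y z : K) (a b : ℝ), 0 ≤ a → 0 ≤ b →
    a + b = 1 → (z : E) = a • (x : E) + b • (y : E) → f z = a * f x + b * f y} := rfl
  rw [this]
  simp only [Set.ofPred_forall]
  exact isClosed_iInter fun x => isClosed_iInter fun y => isClosed_iInter fun z =>
    isClosed_iInter fun a => isClosed_iInter fun b => isClosed_iInter fun _ =>
    isClosed_iInter fun _ => isClosed_iInter fun _ => isClosed_iInter fun _ =>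
    isClosed_eq (heval z) (((heval x).const_mul a).add ((heval y).const_mul b))

/-- A boundary of `K` meets the maximum set of each function in `affineContinuousMaps K`. -/
theorem IsBoundary.exists_forall_le {E : Type*} [AddCommGroup E] [Module ℝ E]
    [TopologicalSpace E] {K B : Set E} (hB : IsBoundary K B) (hK : Convex ℝ K) {f : C(K, ℝ)}
    (hf : f ∈ affineContinuousMaps K) : ∃ b : K, (b : E) ∈ B ∧ ∀ x, f x ≤ f b := by
  classical
  let F : E → ℝ := fun e => if h : e ∈ K then f ⟨e, h⟩ else 0
  have hF : ∀ x : K, F x = f x := fun x => by simp [F]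
  have hcont : ContinuousOn F K := by
    rw [continuousOn_iff_continuous_domRestrict]
    exact f.continuous.congr fun x => (hF x).symm
  have haff : IsAffineOn K F := by
    intro x hx y hy a b ha hb hab
    have hz := hK hx hy ha hb hab
    rw [hF ⟨_, hz⟩, hF ⟨x, hx⟩, hF ⟨y, hy⟩]
    exact hf _ _ _ a b ha hb hab rfl
  obtain ⟨b, hb, hmax⟩ := hB.2 F hcont haff
  refine ⟨⟨b, hB.1 hb⟩, hb, fun x => ?_⟩
  rw [← hF, ← hF]
  exact hmax x.2

/-- A nonempty subspace with a countable network has a sequence of nonempty sets in the ambient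
space which is a network at each of its points. -/
theorem HasCountableNetwork.exists_seq {E : Type*} [TopologicalSpace E] {B : Set E}
    (h : HasCountableNetwork B) (hne : B.Nonempty) :
    ∃ N : ℕ → Set E, (∀ k, (N k).Nonempty ∧ N k ⊆ B) ∧
      ∀ b ∈ B, ∀ U, IsOpen U → b ∈ U → ∃ k, b ∈ N k ∧ N k ⊆ U := by
  obtain ⟨𝒩, hcount, hnet⟩ := h
  have hmem : ∀ b (hb : b ∈ B) (U : Set E), IsOpen U → b ∈ U →
      ∃ s ∈ 𝒩, (⟨b, hb⟩ : B) ∈ s ∧ Subtype.val '' s ⊆ U := by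
    intro b hb U hU hbU
    obtain ⟨M, hM, hMU⟩ := hnet (Subtype.val ⁻¹' U) (hU.preimage continuous_subtype_val)
    have hbM : (⟨b, hb⟩ : B) ∈ ⋃₀ M := hMU ▸ hbU
    obtain ⟨s, hs, hbs⟩ := hbM
    refine ⟨s, hM hs, hbs, Set.image_subset_iff.mpr ?_⟩
    rw [hMU]
    exact Set.subset_sUnion_of_mem hs
  -- Empty members are discarded because the suprema over network sets must be taken over nonempty
  -- sets.
  let 𝒩' : Set (Set B) := {s ∈ 𝒩 | s.Nonempty}
  have hcount' : 𝒩'.Countable := hcount.mono fun s hs => hs.1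
  have hne' : 𝒩'.Nonempty := by
    obtain ⟨b, hb⟩ := hne
    obtain ⟨s, hs, hbs, -⟩ := hmem b hb Set.univ isOpen_univ trivial
    exact ⟨s, hs, _, hbs⟩
  obtain ⟨N, hN⟩ := hcount'.exists_eq_range hne'
  have hNmem : ∀ k, N k ∈ 𝒩' := fun k => hN ▸ Set.mem_range_self k
  refine ⟨fun k => Subtype.val '' N k, fun k => ⟨(hNmem k).2.image _, ?_⟩, ?_⟩
  · rintro _ ⟨b, -, rfl⟩
    exact b.2
  · intro b hb U hU hbU
    obtain ⟨s, hs, hbs, hsU⟩ := hmem b hb U hU hbU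
    have hs' : s ∈ 𝒩' := ⟨hs, _, hbs⟩
    rw [hN] at hs'
    obtain ⟨k, rfl⟩ := hs'
    exact ⟨k, ⟨_, hbs, rfl⟩, hsU⟩

theorem theoremt {E : Type*} [AddCommGroup E] [Module ℝ E] [TopologicalSpace E]
    [IsTopologicalAddGroup E] [ContinuousSMul ℝ E] [LocallyConvexSpace ℝ E] [T2Space E]
    (K B : Set E) (hKcompact : IsCompact K) (hKconvex : Convex ℝ K)
    (hB : IsBoundary K B) (hnet : HasCountableNetwork B) :
    TopologicalSpace.MetrizableSpace K := by
  have : CompactSpace K := isCompact_iff_compactSpace.mp hKcompact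
  have hne : B.Nonempty := by
    obtain ⟨b, hb, -⟩ := hB.exists_forall_le hKconvex (affineContinuousMaps K).zero_mem
    exact ⟨b, hb⟩
  obtain ⟨N, hN, hNB⟩ := hnet.exists_seq hne
  refine metrizableSpace_of_boundary_network (isClosed_affineContinuousMaps K)
    (B := Subtype.val ⁻¹' B) (N := fun k => Subtype.val ⁻¹' N k) ?_ ?_ ?_ ?_ ?_
  · intro x y z a b _ _ hab _
    simp [hab]
  · intro x y hxy
    -- Local convexity and the Hausdorff property enter here: continuous linear functionals restrict
    -- to affine functions that separate points.
    obtain ⟨φ, hφ⟩ := geometric_hahn_banach_point_point (Subtype.coe_ne_coe.mpr hxy)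
    refine ⟨⟨fun x => φ x, φ.continuous.comp continuous_subtype_val⟩, ?_, hφ.ne⟩
    intro x y z a b _ _ _ hz
    simp [hz]
  · exact fun f hf => hB.exists_forall_le hKconvex hf
  · intro k
    obtain ⟨e, he⟩ := (hN k).1
    exact ⟨⟨e, hB.1 ((hN k).2 he)⟩, he⟩
  · intro b hb U hU hbU
    obtain ⟨V, hV, rfl⟩ := isOpen_induced_iff.mp hU
    obtain ⟨k, hbk, hkV⟩ := hNB b hb V hV hbU
    exact ⟨k, hbk, Set.preimage_mono hkV⟩
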